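/- An ordered rooted binary tree is a rooted tree in which every node is either a leaf or has exactly two children, a left one and a right one; its size is its number of leaves. Let $\mathcal{T}_n$ be the set of ordered rooted binary trees of size $n$, and let $C_n=|\mathcal{T}_n|=\frac{1}{n}\binom{2n-2}{n-1}$ $(n\ge 1)$ be the Catalan number, i.e. $C_n=[x^n]\,\frac{1-\sqrt{1-4x}}{2}$. A tree is a caterpillar if each of its nodes is a leaf or has at least one leaf as a child. For a tree $t$, let $\gamma(t)$ be the size of the biggest caterpillar that is a subtree of $t$, where a subtree of $t$ consists of a node of $t$ together with all of its descendants. Let $E_n(\gamma)=\frac{1}{C_n}\sum_{t\in\mathcal{T}_n}\gamma(t)$ be the average value of $\gamma$ over $\mathcal{T}_n$. Set $$\tilde U(x)=\frac12+\frac1{2\sqrt2}+\sqrt{1-4x}\left(-\frac1{\sqrt2}+\log_2\sqrt{1-4x}+\frac14\right),$$ and let $[x^n]\tilde U(x)$ denote the $n$-th coefficient of its Taylor expansion at $0$. Then, as $n\to\infty$, $$E_n(\gamma)\sim\frac{[x^n]\tilde U(x)}{C_n},$$ i.e. the ratio of the two sides tends to $1$. -/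

import Mathlib

namespace CaterpillarTrees

open BinaryTree

/- Ordered rooted binary trees (every internal node has an ordered pair of children) are the terms of
`BinaryTree Unit`: `nil` is a single leaf and `node () l r` is a root with left subtree `l` and
right subtree `r`. The size of a tree is its number of leaves, `BinaryTree.numLeaves`. -/

/-- The finite set of ordered rooted binary trees of size `n`, i.e. with exactly `n` leaves. -/
def treesOfSize : ℕ → Finset (BinaryTree Unit)
  | 0 => ∅
  | n + 1 => treesOfNumNodesEq n

theorem mem_treesOfSize {n : ℕ} {t : BinaryTree Unit} : t ∈ treesOfSize n ↔ t.numLeaves = n := by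
  cases n with
  | zero => simpa [treesOfSize] using t.numLeaves_pos.ne'
  | succ n => simp [treesOfSize, numLeaves_eq_numNodes_succ]

/-- The subtrees of a tree: for each node (internal node or leaf), the tree that consists of
this node and all of its descendants. -/
def subtrees : BinaryTree Unit → Finset (BinaryTree Unit)
  | nil => {nil}
  | node a l r => {node a l r} ∪ (subtrees l ∪ subtrees r)

/-- The root of the tree is a leaf, or at least one of its two children is a leaf. -/
def RootLeafOrHasLeafChild : BinaryTree Unit → Prop
  | nil => True
  | node _ l r => l = nil ∨ r = nil

/-- A tree is a caterpillar if each of its nodes is a leaf or has at least one leaf as a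
direct descendant. -/
def IsCaterpillar (t : BinaryTree Unit) : Prop :=
  ∀ s ∈ subtrees t, RootLeafOrHasLeafChild s

open Classical in
/-- `γ t` is the size of the biggest caterpillar that is a subtree of `t`. -/
noncomputable def γ (t : BinaryTree Unit) : ℕ :=
  ((subtrees t).filter IsCaterpillar).sup numLeaves

/-- `γ t` is attained: it really is a maximum over a nonempty set. -/
theorem isGreatest_γ (t : BinaryTree Unit) :
    IsGreatest {m : ℕ | ∃ s ∈ subtrees t, IsCaterpillar s ∧ s.numLeaves = m} (γ t) := by
  classical
  have hnil : ∀ t : BinaryTree Unit, nil ∈ subtrees t := by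
    intro t
    induction t with
    | nil => simp [subtrees]
    | node a l r hl hr => simp [subtrees, hl]
  have hne : ((subtrees t).filter IsCaterpillar).Nonempty :=
    ⟨nil, by simp [hnil, IsCaterpillar, subtrees, RootLeafOrHasLeafChild]⟩
  constructor
  · obtain ⟨s, hs, h⟩ := Finset.exists_mem_eq_sup _ hne numLeaves
    rw [Finset.mem_filter] at hs
    exact ⟨s, hs.1, hs.2, by rw [γ, h]⟩
  · rintro m ⟨s, hs, hc, rfl⟩
    exact Finset.le_sup (f := numLeaves) (Finset.mem_filter.2 ⟨hs, hc⟩)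

/-- The average value of `γ` over all ordered rooted binary trees of size `n`, equally likely. -/
noncomputable def E (n : ℕ) : ℝ :=
  (∑ t ∈ treesOfSize n, (γ t : ℝ)) / ((treesOfSize n).card : ℝ)

/-- The `n`-th Catalan number in the indexing by the number of leaves: the sequence
`0, 1, 1, 2, 5, 14, …` of the coefficients of `(1 - √(1 - 4 x)) / 2`. -/
def C : ℕ → ℕ
  | 0 => 0
  | n + 1 => catalan n

/-- `C n` is the number of ordered rooted binary trees of size `n`. -/
theorem card_treesOfSize (n : ℕ) : (treesOfSize n).card = C n := by
  cases n with
  | zero => rfl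
  | succ n => exact treesOfNumNodesEq_card_eq_catalan n

/-- The function `Ũ`. -/
noncomputable def Utilde (x : ℝ) : ℝ :=
  1 / 2 + 1 / (2 * √2) + √(1 - 4 * x) * (-(1 / √2) + Real.logb 2 (√(1 - 4 * x)) + 1 / 4)

/-- `[xⁿ] f`, the `n`-th coefficient of the Taylor expansion of `f` at `0`. -/
noncomputable def taylorCoeff (f : ℝ → ℝ) (n : ℕ) : ℝ :=
  iteratedDeriv n f 0 / (n.factorial : ℝ)

/-- `Ũ` is analytic at `0`, so that its Taylor coefficients there are genuine ones. -/
theorem analyticAt_Utilde : AnalyticAt ℝ Utilde 0 := by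
  have h1 : AnalyticAt ℝ (fun x : ℝ => 1 - 4 * x) 0 := by fun_prop
  have h2 : AnalyticAt ℝ (fun x : ℝ => √(1 - 4 * x)) 0 := by
    have h : AnalyticAt ℝ (fun x : ℝ => Real.exp (Real.log (1 - 4 * x) / 2)) 0 :=
      ((h1.log (by norm_num)).div_const).rexp
    refine h.congr ?_
    have : ∀ᶠ x : ℝ in nhds 0, 0 < 1 - 4 * x :=
      h1.continuousAt.eventually (lt_mem_nhds (by norm_num))
    filter_upwards [this] with x hx
    rw [← Real.log_sqrt hx.le, Real.exp_log (Real.sqrt_pos.2 hx)]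
  have h3 : AnalyticAt ℝ (fun x : ℝ => Real.logb 2 (√(1 - 4 * x))) 0 :=
    (h2.log (by norm_num)).div_const
  exact analyticAt_const.add (h2.mul ((analyticAt_const.add h3).add analyticAt_const))

end CaterpillarTrees

namespace CaterpillarTrees

open BinaryTree Finset Filter Topology

/-! Both sides are asymptotic to `Real.logb 2 n`, and each is compared with it separately. On the
analytic side, `taylorCoeff_Utilde_div` evaluates the quotient exactly: a constant plus `1 / log 2`
times the sum of `2 / (2 j + 1)` over `j < n`.

On the tree side, the size of the largest caterpillar concentrates near `log₂ n`. Upper bound: there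
are `2 ^ q` caterpillars of size `q + 2`, and grafting one onto a marked leaf of a smaller tree
produces every occurrence. Counting occurrences bounds the probability of containing one by `n / 2 ^
q` (`probCaterpillar_le`). Lower bound: the generating function of the trees avoiding size `q + 2`
solves `y = x + y ^ 2 - 2 ^ q * x ^ (q + 2)`. The subtracted term keeps it finite slightly beyond
the Catalan singularity `1 / 4`, so avoidance has probability at most `8 n ^ 2 exp (-n / 2 ^ (q +
3))` (`one_sub_probCaterpillar_le`). Thresholds within `O(log log n)` of `log₂ n` then squeeze `E`.
-/

/-! ### Caterpillars and the behaviour of `γ` at the root. -/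

theorem self_mem_subtrees (t : BinaryTree Unit) : t ∈ subtrees t := by
  cases t <;> simp [subtrees]

theorem numLeaves_le_of_mem_subtrees {s t : BinaryTree Unit} (h : s ∈ subtrees t) :
    s.numLeaves ≤ t.numLeaves := by
  induction t with
  | nil => simp_all [subtrees]
  | node a l r hl hr =>
    simp only [subtrees, mem_union, mem_singleton] at h
    rcases h with rfl | h | h
    · rfl
    · exact (hl h).trans (by simp)
    · exact (hr h).trans (by simp)

theorem isCaterpillar_nil : IsCaterpillar nil := by
  simp [IsCaterpillar, subtrees, RootLeafOrHasLeafChild]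

theorem isCaterpillar_node {a : Unit} {l r : BinaryTree Unit} :
    IsCaterpillar (node a l r) ↔ (l = nil ∨ r = nil) ∧ IsCaterpillar l ∧ IsCaterpillar r := by
  simp only [IsCaterpillar, subtrees, mem_union, mem_singleton]
  constructor
  · intro h
    exact ⟨h _ (.inl rfl), fun s hs => h s (.inr (.inl hs)), fun s hs => h s (.inr (.inr hs))⟩
  · rintro ⟨h, hl, hr⟩ s (rfl | hs | hs)
    exacts [h, hl s hs, hr s hs]

theorem le_γ_iff {t : BinaryTree Unit} {k : ℕ} :
    k ≤ γ t ↔ ∃ s ∈ subtrees t, IsCaterpillar s ∧ k ≤ s.numLeaves := by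
  constructor
  · intro h
    obtain ⟨s, hs, hc, he⟩ := (isGreatest_γ t).1
    exact ⟨s, hs, hc, he ▸ h⟩
  · rintro ⟨s, hs, hc, he⟩
    exact he.trans ((isGreatest_γ t).2 ⟨s, hs, hc, rfl⟩)

theorem γ_le_numLeaves (t : BinaryTree Unit) : γ t ≤ t.numLeaves := by
  obtain ⟨s, hs, -, he⟩ := le_γ_iff.1 (le_refl (γ t))
  exact he.trans (numLeaves_le_of_mem_subtrees hs)

theorem IsCaterpillar.γ_eq {t : BinaryTree Unit} (h : IsCaterpillar t) : γ t = t.numLeaves :=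
  (γ_le_numLeaves t).antisymm (le_γ_iff.2 ⟨t, self_mem_subtrees t, h, le_rfl⟩)

theorem γ_left_le (a : Unit) (l r : BinaryTree Unit) : γ l ≤ γ (node a l r) := by
  obtain ⟨s, hs, h⟩ := le_γ_iff.1 (le_refl (γ l))
  exact le_γ_iff.2 ⟨s, by simp [subtrees, hs], h⟩

theorem γ_right_le (a : Unit) (l r : BinaryTree Unit) : γ r ≤ γ (node a l r) := by
  obtain ⟨s, hs, h⟩ := le_γ_iff.1 (le_refl (γ r))
  exact le_γ_iff.2 ⟨s, by simp [subtrees, hs], h⟩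

/-- If a caterpillar of size at least `k` occurs, but not below the root, then the whole tree is
a caterpillar of size exactly `k`. -/
theorem le_γ_node {a : Unit} {l r : BinaryTree Unit} {k : ℕ} (h : k ≤ γ (node a l r))
    (hl : γ l < k) (hr : γ r < k) :
    IsCaterpillar (node a l r) ∧ (node a l r).numLeaves = k := by
  obtain ⟨s, hs, hc, he⟩ := le_γ_iff.1 h
  simp only [subtrees, mem_union, mem_singleton] at hs
  rcases hs with rfl | hs | hs
  · refine ⟨hc, le_antisymm ?_ he⟩
    -- One child is a leaf, so the other is a caterpillar with exactly one leaf fewer, and its size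
    -- is below `k`.
    obtain ⟨h1 | h1, h2, h3⟩ := isCaterpillar_node.1 hc
    · rw [h3.γ_eq] at hr
      simp only [numLeaves, h1]; omega
    · rw [h2.γ_eq] at hl
      simp only [numLeaves, h1]; omega
  · exact absurd (le_γ_iff.2 ⟨s, hs, hc, he⟩) hl.not_ge
  · exact absurd (le_γ_iff.2 ⟨s, hs, hc, he⟩) hr.not_ge

theorem nil_notMem_pairwiseNode (a b : Finset (BinaryTree Unit)) : nil ∉ pairwiseNode a b := by
  simp [pairwiseNode]

theorem node_mem_pairwiseNode {a b : Finset (BinaryTree Unit)} {u : Unit}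
    {l r : BinaryTree Unit} : node u l r ∈ pairwiseNode a b ↔ l ∈ a ∧ r ∈ b := by
  rw [pairwiseNode, Finset.mem_map]
  constructor
  · rintro ⟨⟨x, y⟩, h, he⟩
    have he' : node () x y = node u l r := he
    injection he' with _ h1 h2
    subst h1 h2
    exact mem_product.1 h
  · intro h
    exact ⟨(l, r), mem_product.2 h, rfl⟩

theorem card_pairwiseNode (a b : Finset (BinaryTree Unit)) :
    (pairwiseNode a b).card = a.card * b.card := by
  simp [pairwiseNode]

theorem numLeaves_eq_one_iff {t : BinaryTree Unit} : t.numLeaves = 1 ↔ t = nil := by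
  cases t with
  | nil => simp
  | node a l r => have := l.numLeaves_pos; have := r.numLeaves_pos; simp; omega

/-! ### First moment bound for occurrences of caterpillars. -/

/-- The caterpillars with `q + 1` internal nodes. -/
def caterpillars : ℕ → Finset (BinaryTree Unit)
  | 0 => pairwiseNode {nil} {nil}
  | q + 1 => pairwiseNode {nil} (caterpillars q) ∪ pairwiseNode (caterpillars q) {nil}

theorem mem_caterpillars {q : ℕ} {t : BinaryTree Unit} :
    t ∈ caterpillars q ↔ IsCaterpillar t ∧ t.numLeaves = q + 2 := by
  induction q generalizing t with
  | zero =>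
    cases t with
    | nil => simp [caterpillars]
    | node a l r =>
      have hl := l.numLeaves_pos
      have hr := r.numLeaves_pos
      simp only [caterpillars, node_mem_pairwiseNode, mem_singleton, isCaterpillar_node,
        ← numLeaves_eq_one_iff (t := l), ← numLeaves_eq_one_iff (t := r), numLeaves]
      constructor
      · rintro ⟨h1, h2⟩
        rw [numLeaves_eq_one_iff.1 h1, numLeaves_eq_one_iff.1 h2]
        simp [isCaterpillar_nil]
      · rintro ⟨-, h⟩
        omega
  | succ q ih =>
    cases t with
    | nil => simp [caterpillars]
    | node a l r =>
      simp only [caterpillars, node_mem_pairwiseNode, mem_union, mem_singleton,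
        isCaterpillar_node, ih, numLeaves]
      constructor
      · rintro (⟨rfl, h1, h2⟩ | ⟨⟨h1, h2⟩, rfl⟩)
        · exact ⟨⟨.inl rfl, isCaterpillar_nil, h1⟩, by simp [h2]; omega⟩
        · exact ⟨⟨.inr rfl, h1, isCaterpillar_nil⟩, by simp [h2]⟩
      · rintro ⟨⟨h | h, h1, h2⟩, h3⟩
        · refine .inl ⟨h, h2, ?_⟩
          simp [h] at h3; omega
        · refine .inr ⟨⟨h1, ?_⟩, h⟩
          simpa [h] using h3

theorem card_caterpillars (q : ℕ) : (caterpillars q).card = 2 ^ q := by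
  induction q with
  | zero => rw [caterpillars, card_pairwiseNode]; simp
  | succ q ih =>
    rw [caterpillars, card_union_of_disjoint, card_pairwiseNode, card_pairwiseNode, ih]
    · simp; ring
    · rw [Finset.disjoint_left]
      intro t h1 h2
      cases t with
      | nil => exact nil_notMem_pairwiseNode _ _ h1
      | node a l r =>
        rw [node_mem_pairwiseNode, mem_singleton] at h1 h2
        have h3 := (mem_caterpillars.1 h2.1).2
        rw [h1.1] at h3
        simp at h3

/-- The trees with `n` internal nodes that contain a caterpillar of size `k`. -/
noncomputable def treesWithCaterpillar (k n : ℕ) : Finset (BinaryTree Unit) :=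
  (treesOfNumNodesEq n).filter fun t => k ≤ γ t

/-- Union bound at the root: the caterpillar lies in the left subtree, in the right one, or is the
whole tree, and `le_γ_node` then fixes its size. -/
theorem card_treesWithCaterpillar_succ_le (q n : ℕ) :
    (treesWithCaterpillar (q + 2) (n + 1)).card ≤
      ∑ ij ∈ antidiagonal n, ((treesWithCaterpillar (q + 2) ij.1).card * catalan ij.2 +
        catalan ij.1 * (treesWithCaterpillar (q + 2) ij.2).card) +
      if n = q then 2 ^ q else 0 := by
  have hsub : treesWithCaterpillar (q + 2) (n + 1) ⊆
      ((antidiagonal n).biUnion fun ij =>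
        pairwiseNode (treesWithCaterpillar (q + 2) ij.1) (treesOfNumNodesEq ij.2) ∪
        pairwiseNode (treesOfNumNodesEq ij.1) (treesWithCaterpillar (q + 2) ij.2)) ∪
      if n = q then caterpillars q else ∅ := by
    intro t ht
    rw [treesWithCaterpillar, mem_filter, mem_treesOfNumNodesEq] at ht
    obtain ⟨hn, hγ⟩ := ht
    cases t with
    | nil => simp at hn
    | node a l r =>
      simp only [numNodes] at hn
      have hn' : l.numNodes + r.numNodes = n := by omega
      by_cases hl : q + 2 ≤ γ l
      · refine mem_union_left _ (mem_biUnion.2 ⟨(l.numNodes, r.numNodes), ?_, ?_⟩)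
        · simpa using hn'
        · exact mem_union_left _ (node_mem_pairwiseNode.2 ⟨by simp [treesWithCaterpillar, hl],
            by simp⟩)
      by_cases hr : q + 2 ≤ γ r
      · refine mem_union_left _ (mem_biUnion.2 ⟨(l.numNodes, r.numNodes), ?_, ?_⟩)
        · simpa using hn'
        · exact mem_union_right _ (node_mem_pairwiseNode.2 ⟨by simp,
            by simp [treesWithCaterpillar, hr]⟩)
      have h := le_γ_node hγ (not_le.1 hl) (not_le.1 hr)
      have hnq : n = q := by
        have := h.2
        rw [numLeaves_eq_numNodes_succ, numNodes] at this
        omega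
      rw [if_pos hnq]
      exact mem_union_right _ (mem_caterpillars.2 h)
  refine (card_le_card hsub).trans ((card_union_le _ _).trans (add_le_add ?_ ?_))
  · refine card_biUnion_le.trans (sum_le_sum fun ij _ => (card_union_le _ _).trans ?_)
    rw [card_pairwiseNode, card_pairwiseNode, treesOfNumNodesEq_card_eq_catalan,
      treesOfNumNodesEq_card_eq_catalan]
  · split_ifs
    · rw [card_caterpillars]
    · simp

/-- Symmetrizing the sum makes the weights `i + 1` and `j + 1` add up to the constant `n + 2`. The
identity shows that `2 ^ q * centralBinom m` solves the recursion of the union bound with equality.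
-/
theorem two_mul_sum_centralBinom_mul_catalan (n : ℕ) :
    2 * ∑ ij ∈ antidiagonal n, Nat.centralBinom ij.1 * catalan ij.2 =
      Nat.centralBinom (n + 1) := by
  have hswap : ∑ ij ∈ antidiagonal n, Nat.centralBinom ij.1 * catalan ij.2 =
      ∑ ij ∈ antidiagonal n, Nat.centralBinom ij.2 * catalan ij.1 :=
    (Nat.sum_antidiagonal_swap (f := fun ij : ℕ × ℕ => Nat.centralBinom ij.1 * catalan ij.2)).symm
  rw [two_mul]
  nth_rw 2 [hswap]
  rw [← sum_add_distrib, ← succ_mul_catalan_eq_centralBinom, catalan_succ', mul_sum]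
  refine sum_congr rfl fun ij hij => ?_
  rw [← mem_antidiagonal.1 hij, ← succ_mul_catalan_eq_centralBinom,
    ← succ_mul_catalan_eq_centralBinom]
  ring

theorem card_treesWithCaterpillar_eq_zero {q n : ℕ} (h : n ≤ q) :
    (treesWithCaterpillar (q + 2) n).card = 0 := by
  rw [card_eq_zero, treesWithCaterpillar, filter_eq_empty_iff]
  intro t ht hγ
  rw [mem_treesOfNumNodesEq] at ht
  have := γ_le_numLeaves t
  rw [numLeaves_eq_numNodes_succ] at this
  omega

/-- First moment bound: the number of trees in which a caterpillar of size `q + 2` occurs is at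
most the total number of such occurrences. -/
theorem card_treesWithCaterpillar_le (q m : ℕ) :
    (treesWithCaterpillar (q + 2) (m + q + 1)).card ≤ 2 ^ q * Nat.centralBinom m := by
  induction m using Nat.strong_induction_on with
  | _ m ih =>
    refine (card_treesWithCaterpillar_succ_le q (m + q)).trans ?_
    have hswap : ∑ ij ∈ antidiagonal (m + q),
          catalan ij.1 * (treesWithCaterpillar (q + 2) ij.2).card =
        ∑ ij ∈ antidiagonal (m + q), (treesWithCaterpillar (q + 2) ij.1).card * catalan ij.2 := by
      rw [← Nat.sum_antidiagonal_swap]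
      exact sum_congr rfl fun ij _ => mul_comm _ _
    -- Trees with at most `q` internal nodes are too small to contribute, so the index is shifted by
    -- `q + 1`.
    have hsum : ∑ ij ∈ antidiagonal (m + q),
        (treesWithCaterpillar (q + 2) ij.1).card * catalan ij.2 =
        ∑ i ∈ range m, (treesWithCaterpillar (q + 2) (i + q + 1)).card * catalan (m - 1 - i) := by
      rw [Nat.sum_antidiagonal_eq_sum_range_succ
        (fun i j => (treesWithCaterpillar (q + 2) i).card * catalan j),
        show (m + q).succ = (q + 1) + m by omega, sum_range_add, sum_eq_zero, zero_add]
      · refine sum_congr rfl fun i _ => ?_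
        rw [show q + 1 + i = i + q + 1 by omega, show m + q - (i + q + 1) = m - 1 - i by omega]
      · intro i hi
        rw [card_treesWithCaterpillar_eq_zero (by rw [mem_range] at hi; omega), zero_mul]
    rw [sum_add_distrib, hswap, hsum, ← two_mul]
    rcases m with _ | m
    · simp
    · rw [if_neg (by omega), add_zero, ← two_mul_sum_centralBinom_mul_catalan,
        Nat.sum_antidiagonal_eq_sum_range_succ (fun i j => Nat.centralBinom i * catalan j),
        mul_left_comm]
      refine Nat.mul_le_mul_left _ ?_
      rw [mul_sum]
      refine sum_le_sum fun i hi => ?_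
      rw [← mul_assoc]
      exact Nat.mul_le_mul (ih i (mem_range.1 hi)) (by simp)

/-! ### Generating function of caterpillar-free trees beyond `1 / 4`. -/

/-- The weight of a finite set of trees, each leaf counting with a factor `x`. -/
noncomputable def weight (x : ℝ) (F : Finset (BinaryTree Unit)) : ℝ :=
  ∑ t ∈ F, x ^ t.numLeaves

theorem weight_mono {x : ℝ} (hx : 0 ≤ x) {F G : Finset (BinaryTree Unit)} (h : F ⊆ G) :
    weight x F ≤ weight x G :=
  sum_le_sum_of_subset_of_nonneg h fun _ _ _ => pow_nonneg hx _

theorem weight_pairwiseNode (x : ℝ) (F G : Finset (BinaryTree Unit)) :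
    weight x (pairwiseNode F G) = weight x F * weight x G := by
  rw [weight, weight, weight, pairwiseNode, sum_map, sum_mul_sum, sum_product]
  refine sum_congr rfl fun l _ => sum_congr rfl fun r _ => ?_
  change x ^ (l.numLeaves + r.numLeaves) = _
  rw [pow_add]

theorem weight_eq_card_mul {x : ℝ} {k : ℕ} {F : Finset (BinaryTree Unit)}
    (h : ∀ t ∈ F, t.numLeaves = k) : weight x F = F.card * x ^ k := by
  rw [weight, sum_congr rfl fun t ht => by rw [h t ht], sum_const, nsmul_eq_mul]

theorem weight_nil_union_le {x : ℝ} (hx : 0 ≤ x) (F : Finset (BinaryTree Unit)) :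
    weight x ({nil} ∪ F) ≤ x + weight x F := by
  have h := sum_union_inter (s₁ := {nil}) (s₂ := F)
    (f := fun t : BinaryTree Unit => x ^ t.numLeaves)
  have h0 : 0 ≤ ∑ t ∈ {nil} ∩ F, x ^ t.numLeaves := sum_nonneg fun _ _ => pow_nonneg hx _
  rw [sum_singleton, numLeaves, pow_one] at h
  rw [weight, weight]
  linarith

/-- The trees of height less than `N` that contain no caterpillar of size `k`. -/
noncomputable def caterpillarFreeTrees (k : ℕ) : ℕ → Finset (BinaryTree Unit)
  | 0 => ∅
  | N + 1 => {nil} ∪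
      (pairwiseNode (caterpillarFreeTrees k N) (caterpillarFreeTrees k N)).filter fun t => γ t < k

theorem mem_caterpillarFreeTrees {k N : ℕ} {t : BinaryTree Unit} (h : t.numLeaves ≤ N)
    (hγ : γ t < k) : t ∈ caterpillarFreeTrees k N := by
  induction N generalizing t with
  | zero => exact absurd t.numLeaves_pos h.not_gt
  | succ N ih =>
    cases t with
    | nil => simp [caterpillarFreeTrees]
    | node a l r =>
      have hl := l.numLeaves_pos
      have hr := r.numLeaves_pos
      simp only [numLeaves] at h
      refine mem_union_right _ (mem_filter.2 ⟨node_mem_pairwiseNode.2 ⟨ih (by omega) ?_,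
        ih (by omega) ?_⟩, hγ⟩)
      · exact (γ_left_le a l r).trans_lt hγ
      · exact (γ_right_le a l r).trans_lt hγ

theorem weight_caterpillarFreeTrees_succ_le {x : ℝ} (hx : 0 ≤ x) (k N : ℕ) :
    weight x (caterpillarFreeTrees k (N + 1)) ≤ x + weight x (caterpillarFreeTrees k N) ^ 2 := by
  rw [caterpillarFreeTrees, sq, ← weight_pairwiseNode]
  exact (weight_nil_union_le hx _).trans
    (add_le_add_right (weight_mono hx (filter_subset _ _)) _)

/-- Once `N ≥ q + 1`, every caterpillar of size `q + 2` appears among the pairs and is filtered out,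
which saves its weight. -/
theorem weight_caterpillarFreeTrees_succ_add_le {x : ℝ} (hx : 0 ≤ x) {q N : ℕ} (h : q + 1 ≤ N) :
    weight x (caterpillarFreeTrees (q + 2) (N + 1)) + 2 ^ q * x ^ (q + 2) ≤
      x + weight x (caterpillarFreeTrees (q + 2) N) ^ 2 := by
  have hw : (2 : ℝ) ^ q * x ^ (q + 2) = weight x (caterpillars q) := by
    rw [weight_eq_card_mul fun t ht => (mem_caterpillars.1 ht).2, card_caterpillars]
    simp
  rw [hw, sq, ← weight_pairwiseNode, caterpillarFreeTrees]
  have h1 := weight_nil_union_le hx ((pairwiseNode (caterpillarFreeTrees (q + 2) N)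
      (caterpillarFreeTrees (q + 2) N)).filter fun t => γ t < q + 2)
  have h2 : caterpillars q ⊆ (pairwiseNode (caterpillarFreeTrees (q + 2) N)
      (caterpillarFreeTrees (q + 2) N)).filter fun t => ¬ γ t < q + 2 := by
    intro t ht
    obtain ⟨hc, hn⟩ := mem_caterpillars.1 ht
    refine mem_filter.2 ⟨?_, by rw [hc.γ_eq, hn]; omega⟩
    cases t with
    | nil => simp at hn
    | node a l r =>
      have hl := l.numLeaves_pos
      have hr := r.numLeaves_pos
      simp only [numLeaves] at hn
      have hl' := γ_le_numLeaves l
      have hr' := γ_le_numLeaves r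
      exact node_mem_pairwiseNode.2 ⟨mem_caterpillarFreeTrees (by omega) (by omega),
        mem_caterpillarFreeTrees (by omega) (by omega)⟩
  have h3 := weight_mono hx h2
  have h4 := sum_filter_add_sum_filter_not (pairwiseNode (caterpillarFreeTrees (q + 2) N)
      (caterpillarFreeTrees (q + 2) N)) (fun t => γ t < q + 2) fun t => x ^ t.numLeaves
  simp only [weight] at *
  linarith

theorem mul_le_two_pow {q : ℕ} (h : 5 ≤ q) : (q + 2) * (q + 3) ≤ 2 ^ (q + 1) := by
  induction q, h using Nat.le_induction with
  | base => norm_num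
  | succ q hq ih => rw [pow_succ]; nlinarith

theorem weight_nonneg {x : ℝ} (hx : 0 ≤ x) (F : Finset (BinaryTree Unit)) : 0 ≤ weight x F :=
  sum_nonneg fun _ _ => pow_nonneg hx _

/-- As long as no caterpillar of size `q + 2` is forbidden yet, the weight stays below `1 / 2` with
a margin that makes up for the distance of the argument from `1 / 4`. -/
theorem weight_caterpillarFreeTrees_le_sub {q N : ℕ} (hq : 5 ≤ q) (hN : N ≤ q + 1) {x : ℝ}
    (hx0 : 0 ≤ x) (hx : x = (1 + 1 / 2 ^ (q + 2)) / 4) :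
    weight x (caterpillarFreeTrees (q + 2) N) ≤ 1 / 2 - 1 / (2 * (N + 2)) := by
  induction N with
  | zero => simp [caterpillarFreeTrees, weight]; norm_num
  | succ N ih =>
    have ih := ih (by omega)
    have h0 := weight_nonneg hx0 (caterpillarFreeTrees (q + 2) N)
    refine (weight_caterpillarFreeTrees_succ_le hx0 _ _).trans ?_
    have hsq := pow_le_pow_left₀ h0 ih 2
    have hNq : N ≤ q := by omega
    -- The iteration `y ↦ y ^ 2 + 1 / 4` preserves the margin with slack `(N + 1) / (4 (N + 2) ^ 2
    -- (N + 3))`, as `h5` records; this must absorb the excess `x - 1 / 4`.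
    have h1 : ((N + 2) * (N + 2) * (N + 3) : ℝ) ≤ (N + 1) * 2 ^ (q + 2) := by
      have h2 : (N + 2) * (N + 3) ≤ 2 ^ (q + 1) :=
        (Nat.mul_le_mul (by omega) (by omega)).trans (mul_le_two_pow hq)
      have h3 : (N + 2) * (N + 2) * (N + 3) ≤ (N + 1) * 2 ^ (q + 2) := by
        calc (N + 2) * (N + 2) * (N + 3) = (N + 2) * ((N + 2) * (N + 3)) := by ring
          _ ≤ (2 * (N + 1)) * 2 ^ (q + 1) := Nat.mul_le_mul (by omega) h2
          _ = _ := by ring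
      exact_mod_cast h3
    have h4 : (1 : ℝ) / 2 ^ (q + 2) ≤ (N + 1) / ((N + 2) * (N + 2) * (N + 3)) := by
      rw [div_le_div_iff₀ (by positivity) (by positivity)]
      linarith
    have h5 : (1 / 2 - 1 / (2 * ((N : ℝ) + 2))) ^ 2 + 1 / 4 +
        (N + 1) / ((N + 2) * (N + 2) * (N + 3)) / 4 =
        1 / 2 - 1 / (2 * ((N : ℝ) + 1 + 2)) := by
      have : (N : ℝ) + 1 + 2 = N + 3 := by ring
      rw [this]
      field_simp
      ring
    push_cast
    linarith

theorem weight_caterpillarFreeTrees_le_half {q : ℕ} (hq : 5 ≤ q) (N : ℕ) {x : ℝ}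
    (hx0 : 0 ≤ x) (hx : x = (1 + 1 / 2 ^ (q + 2)) / 4) :
    weight x (caterpillarFreeTrees (q + 2) N) ≤ 1 / 2 := by
  rcases le_total N (q + 1) with hN | hN
  · refine (weight_caterpillarFreeTrees_le_sub hq hN hx0 hx).trans ?_
    have : (0 : ℝ) ≤ 1 / (2 * (N + 2)) := by positivity
    linarith
  · induction N, hN using Nat.le_induction with
    | base =>
      refine (weight_caterpillarFreeTrees_le_sub hq le_rfl hx0 hx).trans ?_
      have : (0 : ℝ) ≤ 1 / (2 * ((q + 1 : ℕ) + 2)) := by positivity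
      linarith
    | succ N hN ih =>
      have h1 := weight_caterpillarFreeTrees_succ_add_le hx0 hN
      have h0 := weight_nonneg hx0 (caterpillarFreeTrees (q + 2) N)
      have hsq := pow_le_pow_left₀ h0 ih 2
      -- The left side is `x - 1 / 4`. The argument `x` is chosen so that equality would hold with
      -- `x ^ (q + 2)` replaced by `(1 / 4) ^ (q + 2)`, which makes `1 / 2` an invariant bound.
      have h2 : 1 / 2 ^ (q + 2) / 4 ≤ 2 ^ q * x ^ (q + 2) := by
        have h3 : (1 / 4 : ℝ) ^ (q + 2) ≤ x ^ (q + 2) := by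
          refine pow_le_pow_left₀ (by norm_num) ?_ _
          have : (0 : ℝ) ≤ 1 / 2 ^ (q + 2) := by positivity
          rw [hx]; linarith
        calc (1 : ℝ) / 2 ^ (q + 2) / 4 = 2 ^ q * (1 / 4) ^ (q + 2) := by
              rw [show (1 / 4 : ℝ) = (1 / 2) * (1 / 2) by norm_num, mul_pow, pow_add, one_div_pow]
              field_simp
              ring
          _ ≤ _ := by gcongr
      linarith

theorem card_filter_γ_lt_le {q : ℕ} (hq : 5 ≤ q) (n : ℕ) :
    (((treesOfNumNodesEq n).filter fun t => γ t < q + 2).card : ℝ) *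
      ((1 + 1 / 2 ^ (q + 2)) / 4) ^ (n + 1) ≤ 1 / 2 := by
  have hx0 : (0 : ℝ) ≤ (1 + 1 / 2 ^ (q + 2)) / 4 := by positivity
  rw [← weight_eq_card_mul (F := (treesOfNumNodesEq n).filter fun t => γ t < q + 2)]
  · refine (weight_mono hx0 ?_).trans (weight_caterpillarFreeTrees_le_half hq (n + 1) hx0 rfl)
    intro t ht
    rw [mem_filter, mem_treesOfNumNodesEq] at ht
    exact mem_caterpillarFreeTrees (by rw [numLeaves_eq_numNodes_succ, ht.1]) ht.2
  · intro t ht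
    rw [mem_filter, mem_treesOfNumNodesEq] at ht
    rw [numLeaves_eq_numNodes_succ, ht.1]

/-! ### Exact Taylor coefficients of `Utilde`. -/

/-- The derivatives of `√(1 - 4 x)` at `0`. -/
noncomputable def sqrtCoeff : ℕ → ℝ
  | 0 => 1
  | n + 1 => (4 * n - 2) * sqrtCoeff n

/-- The derivatives of `√(1 - 4 x) * (a + b * log (1 - 4 x))` at `0`. -/
noncomputable def sqrtLogCoeff (a b : ℝ) : ℕ → ℝ
  | 0 => a
  | n + 1 => (4 * n - 2) * sqrtLogCoeff a b n - 4 * b * sqrtCoeff n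

/-- This family is closed under differentiation; for `c = 1 / 2 - n` the factor `-4 * c` is the `4 *
n - 2` of the recursions. -/
theorem hasDerivAt_rpow_mul_log (c p q x : ℝ) (hx : 0 < 1 - 4 * x) :
    HasDerivAt (fun x : ℝ => (1 - 4 * x) ^ c * (p + q * Real.log (1 - 4 * x)))
      ((1 - 4 * x) ^ (c - 1) * ((-4 * c * p - 4 * q) + -4 * c * q * Real.log (1 - 4 * x))) x := by
  have h1 : HasDerivAt (fun x : ℝ => 1 - 4 * x) (-4) x := by
    simpa using ((hasDerivAt_id x).const_mul (4 : ℝ)).const_sub 1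
  have h2 := h1.rpow_const (p := c) (Or.inl hx.ne')
  have h3 := ((h1.log hx.ne').const_mul q).const_add p
  refine (h2.mul h3).congr_deriv ?_
  rw [show (1 - 4 * x) ^ c = (1 - 4 * x) ^ (c - 1) * (1 - 4 * x) by
    rw [← Real.rpow_add_one hx.ne']; ring_nf]
  field_simp
  ring

theorem iteratedDeriv_sqrt_mul_log (a b : ℝ) (n : ℕ) {x : ℝ} (hx : 0 < 1 - 4 * x) :
    iteratedDeriv n (fun x : ℝ => (1 - 4 * x) ^ (1 / 2 : ℝ) * (a + b * Real.log (1 - 4 * x))) x =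
      (1 - 4 * x) ^ (1 / 2 - n : ℝ) *
        (sqrtLogCoeff a b n + b * sqrtCoeff n * Real.log (1 - 4 * x)) := by
  induction n generalizing x with
  | zero => simp [sqrtLogCoeff, sqrtCoeff]
  | succ n ih =>
    rw [iteratedDeriv_succ]
    have hev : ∀ᶠ y : ℝ in 𝓝 x, 0 < 1 - 4 * y :=
      (by fun_prop : Continuous fun y : ℝ => 1 - 4 * y).continuousAt.eventually (lt_mem_nhds hx)
    rw [EventuallyEq.deriv_eq (hev.mono fun y hy => ih hy),
      (hasDerivAt_rpow_mul_log _ _ _ x hx).deriv, sqrtLogCoeff, sqrtCoeff]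
    push_cast
    rw [show (1 / 2 - (n + 1) : ℝ) = 1 / 2 - n - 1 by ring]
    ring

theorem sqrtCoeff_succ_eq (n : ℕ) : sqrtCoeff (n + 1) = -2 * catalan n * (n + 1).factorial := by
  have hc : ∀ n : ℕ, (n + 2 : ℝ) * catalan (n + 1) = (4 * n + 2) * catalan n := by
    intro n
    have h1 : ((n : ℝ) + 1 + 1) * catalan (n + 1) = (n + 1).centralBinom := by
      exact_mod_cast succ_mul_catalan_eq_centralBinom (n + 1)
    have h2 : ((n : ℝ) + 1) * catalan n = n.centralBinom := by
      exact_mod_cast succ_mul_catalan_eq_centralBinom n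
    have h3 : ((n : ℝ) + 1) * (n + 1).centralBinom = 2 * (2 * n + 1) * n.centralBinom := by
      exact_mod_cast Nat.succ_mul_centralBinom_succ n
    have h4 : ((n : ℝ) + 1) ≠ 0 := by positivity
    apply mul_left_cancel₀ h4
    rw [← h1, ← h2] at h3
    linear_combination h3
  induction n with
  | zero => simp [sqrtCoeff]
  | succ n ih =>
    rw [sqrtCoeff, ih, Nat.factorial_succ (n + 1)]
    push_cast
    linear_combination (2 * ((n + 1).factorial : ℝ)) * hc n

/-- Dividing by `sqrtCoeff` turns the recursion into a sum with increments `-4 b / (4 n - 2)`; the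
one at `n = 0` is the isolated `2 * b`. -/
theorem sqrtLogCoeff_succ_eq (a b : ℝ) (n : ℕ) :
    sqrtLogCoeff a b (n + 1) =
      sqrtCoeff (n + 1) * (a + 2 * b - b * ∑ j ∈ range n, 2 / (2 * (j : ℝ) + 1)) := by
  induction n with
  | zero => simp [sqrtLogCoeff, sqrtCoeff]; ring
  | succ n ih =>
    rw [sqrtLogCoeff, ih, sqrtCoeff.eq_2 (n + 1), sum_range_succ]
    push_cast
    have : (2 * n + 1 : ℝ) ≠ 0 := by positivity
    field_simp
    ring

theorem taylorCoeff_Utilde_div (n : ℕ) :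
    taylorCoeff Utilde (n + 1) / C (n + 1) =
      2 * (1 / √2) - 1 / 2 - 2 / Real.log 2 +
        (∑ j ∈ range n, 2 / (2 * (j : ℝ) + 1)) / Real.log 2 := by
  have hev : Utilde =ᶠ[𝓝 0] fun x => (1 / 2 + 1 / (2 * √2)) + (1 - 4 * x) ^ (1 / 2 : ℝ) *
      ((-(1 / √2) + 1 / 4) + 1 / (2 * Real.log 2) * Real.log (1 - 4 * x)) := by
    have h : ∀ᶠ x : ℝ in 𝓝 0, 0 < 1 - 4 * x :=
      (by fun_prop : Continuous fun y : ℝ => 1 - 4 * y).continuousAt.eventually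
        (lt_mem_nhds (by norm_num))
    filter_upwards [h] with x hx
    rw [Utilde, ← Real.sqrt_eq_rpow, Real.logb, Real.log_sqrt hx.le]
    ring
  have hfac : ((n + 1).factorial : ℝ) ≠ 0 := by positivity
  have hcat : (catalan n : ℝ) ≠ 0 := by
    have := succ_mul_catalan_eq_centralBinom n
    have := n.centralBinom_pos
    have : catalan n ≠ 0 := by rintro h; simp_all
    exact_mod_cast this
  rw [taylorCoeff, hev.iteratedDeriv_eq, iteratedDeriv_const_add (by omega),
    iteratedDeriv_sqrt_mul_log _ _ _ (by norm_num)]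
  simp only [mul_zero, sub_zero, Real.one_rpow, Real.log_one, add_zero, one_mul]
  rw [sqrtLogCoeff_succ_eq, sqrtCoeff_succ_eq, C]
  have hl : Real.log 2 ≠ 0 := (Real.log_pos (by norm_num)).ne'
  field_simp
  ring

/-! ### Central binomial estimates. -/

theorem centralBinom_sq_mul_le (m : ℕ) : m.centralBinom ^ 2 * (2 * m + 1) ≤ 16 ^ m := by
  induction m with
  | zero => simp
  | succ m ih =>
    have h := Nat.succ_mul_centralBinom_succ m
    have h1 : (m + 1) ^ 2 * ((m + 1).centralBinom ^ 2 * (2 * (m + 1) + 1)) ≤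
        (m + 1) ^ 2 * 16 ^ (m + 1) := by
      calc (m + 1) ^ 2 * ((m + 1).centralBinom ^ 2 * (2 * (m + 1) + 1))
          = ((m + 1) * (m + 1).centralBinom) ^ 2 * (2 * m + 3) := by ring
        _ = (m.centralBinom ^ 2 * (2 * m + 1)) * (4 * ((2 * m + 1) * (2 * m + 3))) := by
          rw [h]; ring
        _ ≤ 16 ^ m * (4 * (4 * (m + 1) ^ 2)) := by
          refine Nat.mul_le_mul ih ?_
          nlinarith
        _ = _ := by ring
    exact Nat.le_of_mul_le_mul_left h1 (by positivity)

theorem le_centralBinom_sq_mul {n : ℕ} (hn : 1 ≤ n) : 16 ^ n ≤ n.centralBinom ^ 2 * (4 * n) := by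
  induction n, hn using Nat.le_induction with
  | base => simp [Nat.centralBinom, Nat.choose]
  | succ m hm ih =>
    have h := Nat.succ_mul_centralBinom_succ m
    have h1 : (m * (m + 1)) * 16 ^ (m + 1) ≤
        (m * (m + 1)) * ((m + 1).centralBinom ^ 2 * (4 * (m + 1))) := by
      calc (m * (m + 1)) * 16 ^ (m + 1) = 16 ^ m * (16 * (m * (m + 1))) := by ring
        _ ≤ m.centralBinom ^ 2 * (4 * m) * (4 * (2 * m + 1) ^ 2) := by
          refine Nat.mul_le_mul ih ?_
          nlinarith
        _ = 4 * m * (2 * (2 * m + 1) * m.centralBinom) ^ 2 := by ring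
        _ = _ := by rw [← h]; ring
    exact Nat.le_of_mul_le_mul_left h1 (by positivity)

/-- Since `centralBinom m` has order `4 ^ m / √m`, and `n - j ≥ n / 2`, the square-root factors cost
only a constant. -/
theorem centralBinom_sub_le {n j : ℕ} (hn : 1 ≤ n) (hj : 2 * j ≤ n) :
    4 ^ j * (n - j).centralBinom ≤ 2 * n.centralBinom := by
  have h1 := centralBinom_sq_mul_le (n - j)
  have h2 := le_centralBinom_sq_mul hn
  have h3 : n * (4 ^ j * (n - j).centralBinom) ^ 2 ≤ n * (2 * n.centralBinom) ^ 2 := by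
    calc n * (4 ^ j * (n - j).centralBinom) ^ 2
        = 16 ^ j * ((n - j).centralBinom ^ 2 * n) := by
          rw [mul_pow, ← pow_mul, mul_comm j 2, pow_mul]; norm_num; ring
      _ ≤ 16 ^ j * ((n - j).centralBinom ^ 2 * (2 * (n - j) + 1)) := by gcongr; omega
      _ ≤ 16 ^ j * 16 ^ (n - j) := by gcongr
      _ = 16 ^ n := by rw [← pow_add]; congr 1; omega
      _ ≤ _ := h2.trans_eq (by ring)
  exact (Nat.pow_le_pow_iff_left two_ne_zero).1 (Nat.le_of_mul_le_mul_left h3 (by omega))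

theorem catalan_pos (n : ℕ) : 0 < catalan n := by
  have := succ_mul_catalan_eq_centralBinom n
  have := n.centralBinom_pos
  exact Nat.pos_of_ne_zero (by rintro h; simp_all)

/-! ### Tail probabilities and bounds for the average. -/

/-- The probability that a random tree with `n` internal nodes contains a caterpillar of
size `k`. -/
noncomputable def probCaterpillar (k n : ℕ) : ℝ :=
  (treesWithCaterpillar k n).card / catalan n

theorem probCaterpillar_nonneg (k n : ℕ) : 0 ≤ probCaterpillar k n := by
  unfold probCaterpillar; positivity

theorem probCaterpillar_le {q n : ℕ} (hn : 1 ≤ n) (hq : 2 * (q + 1) ≤ n) :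
    probCaterpillar (q + 2) n ≤ n / 2 ^ q := by
  have h1 := card_treesWithCaterpillar_le q (n - (q + 1))
  rw [show n - (q + 1) + q + 1 = n by omega] at h1
  have h2 := centralBinom_sub_le hn hq
  rw [← succ_mul_catalan_eq_centralBinom n] at h2
  rw [probCaterpillar, div_le_div_iff₀ (by exact_mod_cast catalan_pos n) (by positivity)]
  have h3 : 2 * ((treesWithCaterpillar (q + 2) n).card * 2 ^ q) ≤ 2 * (n * catalan n) := by
    have h4 : 2 * (2 * ((treesWithCaterpillar (q + 2) n).card * 2 ^ q)) ≤
        2 * (2 * (n * catalan n)) := by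
      calc 2 * (2 * ((treesWithCaterpillar (q + 2) n).card * 2 ^ q))
          ≤ 2 * (2 * (2 ^ q * (n - (q + 1)).centralBinom * 2 ^ q)) := by gcongr
        _ = 4 ^ (q + 1) * (n - (q + 1)).centralBinom := by
          rw [show 4 = 2 * 2 by norm_num, mul_pow]; ring
        _ ≤ 2 * ((n + 1) * catalan n) := h2
        _ ≤ 2 * (2 * (n * catalan n)) := by
          rw [← mul_assoc 2 n]; gcongr; omega
    omega
  have h5 : (treesWithCaterpillar (q + 2) n).card * 2 ^ q ≤ n * catalan n := by omega
  exact_mod_cast h5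

theorem exp_half_le {δ : ℝ} (h0 : 0 ≤ δ) (h1 : δ ≤ 1) : Real.exp (δ / 2) ≤ 1 + δ := by
  have h2 := Real.one_sub_le_exp_neg (δ / 2)
  have h3 : Real.exp (δ / 2) * Real.exp (-(δ / 2)) = 1 := by rw [← Real.exp_add]; simp
  have h4 := Real.exp_pos (δ / 2)
  nlinarith

theorem one_sub_probCaterpillar_le {q n : ℕ} (hn : 1 ≤ n) (hq : 5 ≤ q) :
    1 - probCaterpillar (q + 2) n ≤ 8 * n ^ 2 * Real.exp (-(n / 2 ^ (q + 2) / 2)) := by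
  set δ : ℝ := 1 / 2 ^ (q + 2) with hδ
  have hδ0 : 0 < δ := by positivity
  have hδ1 : δ ≤ 1 := by
    rw [hδ, div_le_one (by positivity)]; exact one_le_pow₀ (by norm_num)
  have hcat : (0 : ℝ) < catalan n := by exact_mod_cast catalan_pos n
  have h1 := card_filter_γ_lt_le hq n
  rw [← hδ] at h1
  set b : ℝ := (((treesOfNumNodesEq n).filter fun t => γ t < q + 2).card : ℝ) with hb
  have hsplit : b = catalan n - (treesWithCaterpillar (q + 2) n).card := by
    have := card_filter_add_card_filter_not (s := treesOfNumNodesEq n) (fun t => γ t < q + 2)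
    rw [treesOfNumNodesEq_card_eq_catalan] at this
    simp only [not_lt] at this
    rw [eq_sub_iff_add_eq, hb, treesWithCaterpillar]
    exact_mod_cast this
  have h2 : (4 : ℝ) ^ n ≤ 2 * n * ((n + 1) * catalan n) := by
    have := Nat.four_pow_le_two_mul_self_mul_centralBinom n hn
    rw [← succ_mul_catalan_eq_centralBinom] at this
    exact_mod_cast this
  have h3 : Real.exp (n * δ / 2) ≤ (1 + δ) ^ (n + 1) := by
    calc Real.exp (n * δ / 2) = Real.exp (δ / 2) ^ n := by rw [← Real.exp_nat_mul]; ring_nf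
      _ ≤ (1 + δ) ^ n := pow_le_pow_left₀ (Real.exp_pos _).le (exp_half_le hδ0.le hδ1) _
      _ ≤ _ := pow_le_pow_right₀ (by linarith) (by omega)
  have hb0 : 0 ≤ b := by positivity
  have h4 : b * Real.exp (n * δ / 2) ≤ 2 * 4 ^ n := by
    rw [div_pow, ← mul_div_assoc, div_le_iff₀ (by positivity), pow_succ 4] at h1
    nlinarith [mul_le_mul_of_nonneg_left h3 hb0]
  have hn' : (1 : ℝ) ≤ n := by exact_mod_cast hn
  have h5 : b * Real.exp (n * δ / 2) ≤ 8 * n ^ 2 * catalan n := by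
    have : (n : ℝ) * ((n + 1) * catalan n) ≤ n * (2 * n * catalan n) := by gcongr; linarith
    linarith
  have h6 : 1 - probCaterpillar (q + 2) n = b / catalan n := by
    rw [probCaterpillar, hsplit]; field_simp
  rw [h6, Real.exp_neg, show (n : ℝ) / 2 ^ (q + 2) / 2 = n * δ / 2 by rw [hδ]; ring,
    div_le_iff₀ hcat, ← div_eq_mul_inv, div_mul_eq_mul_div, le_div_iff₀ (Real.exp_pos _)]
  exact h5

theorem E_succ (n : ℕ) : E (n + 1) = (∑ t ∈ treesOfNumNodesEq n, (γ t : ℝ)) / catalan n := by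
  rw [E, card_treesOfSize]; rfl

theorem le_E_succ (k n : ℕ) : k * probCaterpillar k n ≤ E (n + 1) := by
  rw [E_succ, probCaterpillar, ← mul_div_assoc]
  gcongr
  rw [mul_comm, ← nsmul_eq_mul]
  calc (treesWithCaterpillar k n).card • (k : ℝ) ≤ ∑ t ∈ treesWithCaterpillar k n, (γ t : ℝ) :=
        card_nsmul_le_sum _ _ _ fun t ht => by
          exact_mod_cast (mem_filter.1 ht).2
    _ ≤ _ := sum_le_sum_of_subset_of_nonneg (filter_subset _ _) fun _ _ _ => by positivity

theorem E_succ_le (k m n : ℕ) :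
    E (n + 1) ≤ k + m * probCaterpillar k n + (n + 1) * probCaterpillar m n := by
  have hcat : (0 : ℝ) < catalan n := by exact_mod_cast catalan_pos n
  have hcard : ∀ k : ℕ, ((treesWithCaterpillar k n).card : ℝ) =
      ∑ t ∈ treesOfNumNodesEq n, if k ≤ γ t then 1 else 0 := fun k => by
    rw [treesWithCaterpillar, sum_boole]
  have h : ∑ t ∈ treesOfNumNodesEq n, (γ t : ℝ) ≤ k * catalan n +
      m * (treesWithCaterpillar k n).card + (n + 1) * (treesWithCaterpillar m n).card := by
    rw [hcard, hcard, mul_sum, mul_sum, ← treesOfNumNodesEq_card_eq_catalan, mul_comm (k : ℝ),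
      ← nsmul_eq_mul, ← sum_const, ← sum_add_distrib, ← sum_add_distrib]
    refine sum_le_sum fun t ht => ?_
    have h1 := γ_le_numLeaves t
    rw [numLeaves_eq_numNodes_succ, mem_treesOfNumNodesEq.1 ht] at h1
    -- Two thresholds are needed: the trivial bound `n + 1` is affordable only on the much rarer
    -- event `m ≤ γ t`.
    have h2 : γ t ≤ k + m * (if k ≤ γ t then 1 else 0) + (n + 1) * (if m ≤ γ t then 1 else 0) := by
      split_ifs <;> omega
    exact_mod_cast h2
  rw [E_succ, div_le_iff₀ hcat]
  refine h.trans_eq ?_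
  rw [probCaterpillar, probCaterpillar]
  field_simp

/-! ### Logarithmic growth of the Taylor coefficients. -/

theorem log_le_sum_odd (n : ℕ) :
    Real.log (2 * n + 1) ≤ ∑ j ∈ range n, 2 / (2 * (j : ℝ) + 1) := by
  induction n with
  | zero => simp
  | succ n ih =>
    rw [sum_range_succ]
    have h0 : (0 : ℝ) < 2 * n + 1 := by positivity
    have h := Real.log_le_sub_one_of_pos
      (show (0 : ℝ) < (2 * (n + 1 : ℕ) + 1) / (2 * n + 1) by positivity)
    rw [Real.log_div (by positivity) (by positivity)] at h
    have : (2 * ((n + 1 : ℕ) : ℝ) + 1) / (2 * n + 1) - 1 = 2 / (2 * n + 1) := by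
      push_cast; field_simp; ring
    linarith

theorem sum_odd_le_log {n : ℕ} (hn : 1 ≤ n) :
    ∑ j ∈ range n, 2 / (2 * (j : ℝ) + 1) ≤ 2 + Real.log (2 * n - 1) := by
  induction n, hn using Nat.le_induction with
  | base => norm_num
  | succ n hn ih =>
    rw [sum_range_succ]
    have hn' : (1 : ℝ) ≤ n := by exact_mod_cast hn
    have h0 : (0 : ℝ) < 2 * n - 1 := by linarith
    have h := Real.log_le_sub_one_of_pos
      (show (0 : ℝ) < (2 * n - 1) / (2 * n + 1) by positivity)
    rw [Real.log_div (by positivity) (by positivity)] at h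
    have : (2 * (n : ℝ) - 1) / (2 * n + 1) - 1 = -(2 / (2 * n + 1)) := by
      field_simp; ring
    have h2 : (2 * ((n + 1 : ℕ) : ℝ) - 1) = 2 * n + 1 := by push_cast; ring
    rw [h2]
    linarith

theorem tendsto_logb_natCast : Tendsto (fun n : ℕ => Real.logb 2 n) atTop atTop :=
  (Real.tendsto_logb_atTop (by norm_num)).comp tendsto_natCast_atTop_atTop

theorem tendsto_taylorCoeff_Utilde_div :
    Tendsto (fun n : ℕ => taylorCoeff Utilde (n + 1) / C (n + 1) / Real.logb 2 n) atTop (𝓝 1) := by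
  have hl : 0 < Real.log 2 := Real.log_pos (by norm_num)
  set c := 2 * (1 / √2) - 1 / 2 - 2 / Real.log 2 with hc
  have key : ∀ d : ℝ, Tendsto (fun n : ℕ => (d + Real.logb 2 n) / Real.logb 2 n) atTop (𝓝 1) := by
    intro d
    have h := (tendsto_logb_natCast.const_div_atTop d).add_const 1
    rw [zero_add] at h
    refine h.congr' ?_
    filter_upwards [tendsto_logb_natCast.eventually_gt_atTop 0] with n hn
    field_simp
  refine tendsto_of_tendsto_of_tendsto_of_le_of_le' (key c) (key (c + 3 / Real.log 2)) ?_ ?_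
  · filter_upwards [tendsto_logb_natCast.eventually_gt_atTop 0, eventually_ge_atTop 1] with n hn h1
    rw [taylorCoeff_Utilde_div]
    have h1' : (1 : ℝ) ≤ n := by exact_mod_cast h1
    gcongr
    rw [Real.logb]
    gcongr
    exact (Real.log_le_log (by linarith) (by linarith)).trans (log_le_sum_odd n)
  · filter_upwards [tendsto_logb_natCast.eventually_gt_atTop 0, eventually_ge_atTop 1] with n hn h1
    rw [taylorCoeff_Utilde_div]
    have h1' : (1 : ℝ) ≤ n := by exact_mod_cast h1
    rw [add_assoc]
    gcongr
    rw [Real.logb, ← add_div]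
    gcongr
    refine (sum_odd_le_log h1).trans ?_
    have h2 : Real.log (2 * n - 1) ≤ Real.log (2 * n) :=
      Real.log_le_log (by linarith) (by linarith)
    rw [Real.log_mul (by norm_num) (by positivity)] at h2
    have h3 : Real.log 2 ≤ 1 := by linarith [Real.log_le_sub_one_of_pos (zero_lt_two' ℝ)]
    linarith

/-! ### Logarithmic growth of the average. -/

theorem tendsto_logb_div_self : Tendsto (fun x : ℝ => Real.logb 2 x / x) atTop (𝓝 0) := by
  have h : Tendsto (fun x : ℝ => Real.log x / x) atTop (𝓝 0) :=
    Real.isLittleO_log_id_atTop.tendsto_div_nhds_zero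
  have h2 := h.div_const (Real.log 2)
  rw [zero_div] at h2
  refine h2.congr fun x => ?_
  rw [Real.logb]; ring

theorem two_rpow_logb {n : ℕ} (hn : 1 ≤ n) : (2 : ℝ) ^ Real.logb 2 n = n :=
  Real.rpow_logb (by norm_num) (by norm_num) (by exact_mod_cast hn)

theorem eventually_le_E_succ : ∀ᶠ n : ℕ in atTop,
    (Real.logb 2 n - 2 * Real.logb 2 (Real.logb 2 n) - 1) *
      (1 - 8 * Real.exp (2 * Real.logb 2 n - Real.logb 2 n ^ 2 / 2)) ≤ E (n + 1) := by
  have h7 : ∀ᶠ x : ℝ in atTop, 7 ≤ x - 2 * Real.logb 2 x := by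
    have h := tendsto_logb_div_self.eventually (ge_mem_nhds (show (0 : ℝ) < 1 / 4 by norm_num))
    filter_upwards [h, eventually_ge_atTop 14] with x hx hx14
    rw [div_le_iff₀ (by linarith)] at hx
    linarith
  have h8 : ∀ᶠ x : ℝ in atTop, 8 * Real.exp (2 * x - x ^ 2 / 2) ≤ 1 := by
    filter_upwards [eventually_ge_atTop 10] with x hx
    have h1 := Real.add_one_le_exp (-(2 * x - x ^ 2 / 2))
    rw [Real.exp_neg] at h1
    have h2 : 8 ≤ (Real.exp (2 * x - x ^ 2 / 2))⁻¹ := by nlinarith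
    have h3 := Real.exp_pos (2 * x - x ^ 2 / 2)
    rw [le_inv_comm₀ (by norm_num) h3] at h2
    linarith
  filter_upwards [tendsto_logb_natCast.eventually h7, tendsto_logb_natCast.eventually h8,
    tendsto_logb_natCast.eventually_gt_atTop 0, eventually_ge_atTop 1] with n h7 h8 hℓ hn
  set ℓ := Real.logb 2 n with hℓdef
  -- This size gives `2 ^ (q + 2) ≤ n / ℓ ^ 2`, so the avoidance bound decays like `exp (-ℓ ^ 2 /
  -- 2)` and beats the factor `n ^ 2 ≤ exp (2 * ℓ)`.
  obtain ⟨q, hq⟩ : ∃ q, ⌊ℓ - 2 * Real.logb 2 ℓ⌋₊ = q + 2 := by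
    have : 7 ≤ ⌊ℓ - 2 * Real.logb 2 ℓ⌋₊ := Nat.le_floor (by exact_mod_cast h7)
    exact ⟨_, (Nat.sub_add_cancel (by omega)).symm⟩
  have hq5 : 5 ≤ q := by
    have : 7 ≤ ⌊ℓ - 2 * Real.logb 2 ℓ⌋₊ := Nat.le_floor (by exact_mod_cast h7)
    omega
  have hn0 : (0 : ℝ) < n := by exact_mod_cast hn
  have hk1 : ℓ - 2 * Real.logb 2 ℓ - 1 ≤ (q + 2 : ℕ) := by
    have := Nat.lt_floor_add_one (ℓ - 2 * Real.logb 2 ℓ)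
    rw [hq] at this
    linarith
  have hk2 : (2 : ℝ) ^ (q + 2) ≤ n / ℓ ^ 2 := by
    have h := Nat.floor_le (show 0 ≤ ℓ - 2 * Real.logb 2 ℓ by linarith)
    rw [hq] at h
    calc (2 : ℝ) ^ (q + 2) = (2 : ℝ) ^ ((q + 2 : ℕ) : ℝ) := (Real.rpow_natCast _ _).symm
      _ ≤ (2 : ℝ) ^ (ℓ - 2 * Real.logb 2 ℓ) := Real.rpow_le_rpow_of_exponent_le (by norm_num) h
      _ = n / ℓ ^ 2 := by
        rw [Real.rpow_sub (by norm_num), hℓdef, two_rpow_logb hn, ← hℓdef, mul_comm,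
          Real.rpow_mul (by norm_num), Real.rpow_logb (by norm_num) (by norm_num) hℓ]
        norm_num
  have hP := one_sub_probCaterpillar_le hn hq5
  have hexp : 8 * (n : ℝ) ^ 2 * Real.exp (-(n / 2 ^ (q + 2) / 2)) ≤
      8 * Real.exp (2 * ℓ - ℓ ^ 2 / 2) := by
    have h1 : ℓ ^ 2 ≤ n / 2 ^ (q + 2) := by
      rw [le_div_iff₀ (by positivity)]
      rw [le_div_iff₀ (by positivity)] at hk2
      linarith
    have h2 : (n : ℝ) ≤ Real.exp ℓ := by
      rw [← Real.log_le_iff_le_exp hn0]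
      rw [hℓdef, Real.logb, le_div_iff₀ (Real.log_pos (by norm_num))]
      have h3 : Real.log 2 ≤ 1 := by linarith [Real.log_le_sub_one_of_pos (zero_lt_two' ℝ)]
      have h4 : 0 ≤ Real.log n := Real.log_natCast_nonneg n
      nlinarith
    rw [sub_eq_add_neg, Real.exp_add, mul_assoc]
    have h5 : Real.exp (2 * ℓ) = Real.exp ℓ ^ 2 := by rw [← Real.exp_nat_mul]; norm_num
    rw [h5]
    gcongr
  calc (ℓ - 2 * Real.logb 2 ℓ - 1) * (1 - 8 * Real.exp (2 * ℓ - ℓ ^ 2 / 2))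
      ≤ (q + 2 : ℕ) * probCaterpillar (q + 2) n :=
        mul_le_mul hk1 (by linarith) (by linarith) (by positivity)
    _ ≤ _ := le_E_succ _ _

theorem eventually_E_succ_le : ∀ᶠ n : ℕ in atTop,
    E (n + 1) ≤ (Real.logb 2 n + Real.logb 2 (Real.logb 2 n) + 3) +
      (2 * Real.logb 2 n + 3) / Real.logb 2 n + 2 := by
  have hbig : ∀ᶠ n : ℕ in atTop, 4 * Real.logb 2 n + 4 ≤ n := by
    have h := (tendsto_logb_div_self.comp tendsto_natCast_atTop_atTop).eventually
      (ge_mem_nhds (show (0 : ℝ) < 1 / 8 by norm_num))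
    filter_upwards [h, eventually_ge_atTop 8] with n hn h8
    have h8' : (8 : ℝ) ≤ n := by exact_mod_cast h8
    simp only [Function.comp_apply] at hn
    rw [div_le_iff₀ (by linarith)] at hn
    linarith
  filter_upwards [hbig, tendsto_logb_natCast.eventually_ge_atTop 1, eventually_ge_atTop 1]
    with n hbig hℓ hn
  set ℓ := Real.logb 2 n with hℓdef
  have hn0 : (0 : ℝ) < n := by exact_mod_cast hn
  have hn1 : (1 : ℝ) ≤ n := by exact_mod_cast hn
  have hbound : ∀ y : ℝ, 0 ≤ y → y ≤ 2 * ℓ →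
      probCaterpillar (⌈y⌉₊ + 2) n ≤ n / (2 : ℝ) ^ y := by
    intro y hy0 hy
    have h1 := (Nat.ceil_lt_add_one hy0).le
    refine (probCaterpillar_le hn ?_).trans ?_
    · have : (2 * (⌈y⌉₊ + 1) : ℝ) ≤ n := by linarith
      exact_mod_cast this
    · gcongr
      rw [← Real.rpow_natCast]
      exact Real.rpow_le_rpow_of_exponent_le (by norm_num) (Nat.le_ceil y)
  have hll0 : 0 ≤ Real.logb 2 ℓ := Real.logb_nonneg (by norm_num) hℓ
  have hll : Real.logb 2 ℓ ≤ ℓ := by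
    rw [Real.logb_le_iff_le_rpow (by norm_num) (by linarith), hℓdef, two_rpow_logb hn, ← hℓdef]
    linarith
  -- The two thresholds have tail probabilities at most `1 / ℓ` and `1 / n`, so both error terms of
  -- `E_succ_le` stay bounded.
  have hK := hbound (ℓ + Real.logb 2 ℓ) (by linarith) (by linarith)
  have hM := hbound (2 * ℓ) (by linarith) le_rfl
  have h2 : (2 : ℝ) ^ ℓ = n := two_rpow_logb hn
  have h2' : (2 : ℝ) ^ Real.logb 2 ℓ = ℓ :=
    Real.rpow_logb (by norm_num) (by norm_num) (by linarith)
  rw [Real.rpow_add (by norm_num), h2, h2', ← div_div, div_self hn0.ne'] at hK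
  rw [two_mul, Real.rpow_add (by norm_num), h2, ← div_div, div_self hn0.ne', ← two_mul] at hM
  have hK' := (Nat.ceil_lt_add_one (show 0 ≤ ℓ + Real.logb 2 ℓ by linarith)).le
  have hM' := (Nat.ceil_lt_add_one (show 0 ≤ 2 * ℓ by linarith)).le
  refine (E_succ_le (⌈ℓ + Real.logb 2 ℓ⌉₊ + 2) (⌈2 * ℓ⌉₊ + 2) n).trans ?_
  refine add_le_add (add_le_add ?_ ?_) ?_
  · push_cast; linarith
  · rw [div_eq_mul_one_div]
    exact mul_le_mul (by push_cast; linarith) hK (probCaterpillar_nonneg _ _) (by linarith)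
  · calc ((n : ℝ) + 1) * probCaterpillar (⌈2 * ℓ⌉₊ + 2) n ≤ (n + 1) * (1 / n) := by gcongr
      _ ≤ 2 := by rw [mul_one_div, div_le_iff₀ hn0]; linarith

theorem tendsto_E_succ_div : Tendsto (fun n : ℕ => E (n + 1) / Real.logb 2 n) atTop (𝓝 1) := by
  have hinv : Tendsto (fun x : ℝ => x⁻¹) atTop (𝓝 0) := tendsto_inv_atTop_zero
  have hlow : Tendsto (fun x : ℝ => (1 - 2 * (Real.logb 2 x / x) - x⁻¹) *
      (1 - 8 * Real.exp (2 * x - x ^ 2 / 2))) atTop (𝓝 1) := by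
    have h1 : Tendsto (fun x : ℝ => 2 * x - x ^ 2 / 2) atTop atBot := by
      refine tendsto_atBot_mono' _ ?_ tendsto_neg_atTop_atBot
      filter_upwards [eventually_ge_atTop 6] with x hx
      nlinarith
    have h2 := ((Real.tendsto_exp_atBot.comp h1).const_mul 8).const_sub 1
    have h3 := ((tendsto_logb_div_self.const_mul 2).const_sub 1).sub hinv
    simpa using h3.mul h2
  have hup : Tendsto (fun x : ℝ => 1 + Real.logb 2 x / x + 7 * x⁻¹ + 3 * x⁻¹ * x⁻¹)
      atTop (𝓝 1) := by
    have h := ((tendsto_logb_div_self.const_add 1).add (hinv.const_mul 7)).add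
      ((hinv.const_mul 3).mul hinv)
    simpa using h
  refine tendsto_of_tendsto_of_tendsto_of_le_of_le' (hlow.comp tendsto_logb_natCast)
    (hup.comp tendsto_logb_natCast) ?_ ?_
  · filter_upwards [eventually_le_E_succ, tendsto_logb_natCast.eventually_gt_atTop 0] with n h hn
    rw [Function.comp_apply, le_div_iff₀ hn]
    refine le_trans (le_of_eq ?_) h
    field_simp
  · filter_upwards [eventually_E_succ_le, tendsto_logb_natCast.eventually_gt_atTop 0] with n h hn
    rw [Function.comp_apply, div_le_iff₀ hn]
    refine h.trans (le_of_eq ?_)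
    field_simp
    ring

end CaterpillarTrees

theorem mainTheorem6 :
    Asymptotics.IsEquivalent Filter.atTop
      (fun n : ℕ => CaterpillarTrees.E n)
      (fun n : ℕ =>
        CaterpillarTrees.taylorCoeff CaterpillarTrees.Utilde n / (CaterpillarTrees.C n : ℝ)) := by
  have hne : ∀ᶠ n : ℕ in Filter.atTop, Real.logb 2 n ≠ 0 :=
    (CaterpillarTrees.tendsto_logb_natCast.eventually_gt_atTop 0).mono fun n hn => hn.ne'
  have h1 := (Asymptotics.isEquivalent_iff_tendsto_one hne).2 CaterpillarTrees.tendsto_E_succ_div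
  have h2 := (Asymptotics.isEquivalent_iff_tendsto_one hne).2
    CaterpillarTrees.tendsto_taylorCoeff_Utilde_div
  have h3 := (h1.trans h2.symm).isLittleO
  -- The estimates are indexed by internal nodes, one fewer than leaves, hence the shift by `1`.
  rw [Asymptotics.IsEquivalent, ← Filter.map_add_atTop_eq_nat 1, Asymptotics.isLittleO_map]
  exact h3
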